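/- Let $\mathcal{Y}$ be a measurable space (e.g. a metric space with its Borel sets), $\{\mu_\theta:\theta\in\Theta\subseteq\mathbb{R}^p\}$ a statistical model of probability measures on $\mathcal{Y}$ depending measurably on $\theta$, and $\pi$ a prior probability measure on $\Theta$. Let $g:\mathcal{Y}\to[1,\infty)$ be measurable and $\mathfrak{F}$ a class of measurable functions $f:\mathcal{Y}\to\mathbb{R}$ with $\sup_y|f(y)|/g(y)<\infty$, and let $$\mathcal{D}_{\mathfrak F}(\mu_1,\mu_2)=\sup_{f\in\mathfrak F}\Big|\int f\,d\mu_1-\int f\,d\mu_2\Big|$$ be the associated integral probability semimetric; assume that for all $n$ and all $a\in\mathbb{R}^n$ the function $x_{1:n}\mapsto\sup_{f\in\mathfrak F}|\sum_{i}a_if(x_i)|$ is measurable. Let $y_1,y_2,\dots$ be i.i.d. from a probability measure $\mu^*$ on $\mathcal{Y}$, and for $\varepsilon>0$ let the ABC posterior be $$\pi_n^{(\varepsilon)}(d\theta)=\frac{p_n(\theta)}{p_n}\,\pi(d\theta),\qquad p_n(\theta)=\int_{\mathcal{Y}^n}\mathbf 1\{\mathcal{D}_{\mathfrak F}(\hat\mu_{z_{1:n}},\hat\mu_{y_{1:n}})\le\varepsilon\}\,\mu_\theta^n(dz_{1:n}),\qquad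 p_n=\int_\Theta p_n(\theta)\,\pi(d\theta),$$ where $\hat\mu_{x_{1:n}}=n^{-1}\sum_{i=1}^n\delta_{x_i}$. Assume that 1. $\mathfrak F$ is uniformly bounded: there is $b>0$ with $\|f\|_\infty\le b$ for all $f\in\mathfrak F$; 2. $\mathfrak{R}_n(\mathfrak F):=\sup_{\mu}\mathbb{E}\big[\sup_{f\in\mathfrak F}\big|\frac1n\sum_{i=1}^n\epsilon_if(x_i)\big|\big]\to0$ as $n\to\infty$, where the first supremum is over all probability measures $\mu$ on $\mathcal{Y}$, $x_1,\dots,x_n$ are i.i.d. from $\mu$, and $\epsilon_1,\dots,\epsilon_n$ are i.i.d. Rademacher signs independent of them. Let $\tilde\varepsilon=\inf\{e>0:\pi\{\theta:\mathcal{D}_{\mathfrak F}(\mu_\theta,\mu^*)\le e\}>0\}$. Then for every $\varepsilon>\tilde\varepsilon$ we have $\pi\{\theta:\mathcal{D}_{\mathfrak F}(\mu_\theta,\mu^*)\le\varepsilon\}>0$ and, almost surely with respect to the data, $p_n>0$ for all $n$ large enough, so that $\pi_n^{(\varepsilon)}$ is well defined. If moreover $\pi\{\theta:\mathcal{D}_{\mathfrak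 F}(\mu_\theta,\mu^*)=\varepsilon\}=0$ (which holds for all but countably many $\varepsilon$), then, almost surely with respect to the data, as $n\to\infty$, $$\pi_n^{(\varepsilon)}\longrightarrow\pi\big(\,\cdot\mid\mathcal{D}_{\mathfrak F}(\mu_\theta,\mu^*)\le\varepsilon\big)$$ in total variation, and the densities with respect to $\pi$ converge, $$\frac{p_n(\theta)}{p_n}\longrightarrow\frac{\mathbf 1\{\mathcal{D}_{\mathfrak F}(\mu_\theta,\mu^*)\le\varepsilon\}}{\pi\{\theta':\mathcal{D}_{\mathfrak F}(\mu_{\theta'},\mu^*)\le\varepsilon\}},$$ for every $\theta\in\Theta$ with $\mathcal{D}_{\mathfrak F}(\mu_\theta,\mu^*)\ne\varepsilon$. -/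

import Mathlib

open MeasureTheory ProbabilityTheory Filter Topology
open scoped ENNReal

noncomputable section

namespace ABC

variable {Y : Type*} [MeasurableSpace Y] {T : Type*} [MeasurableSpace T]

/-- The set `𝔅_g` of all measurable `f : Y → ℝ` with `sup_y |f y| / g y < ∞`. -/
def gBounded (g : Y → ℝ) : Set (Y → ℝ) :=
  {f | Measurable f ∧ BddAbove (Set.range fun y => |f y| / g y)}

/-- The integral probability semimetric
`𝒟_F(μ₁, μ₂) = sup_{f ∈ F} |∫ f dμ₁ - ∫ f dμ₂|`, with values in `[0, ∞]`. -/
def ips (F : Set (Y → ℝ)) (μ₁ μ₂ : Measure Y) : ℝ≥0∞ :=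
  ⨆ f ∈ F, ENNReal.ofReal |(∫ x, f x ∂μ₁) - ∫ x, f x ∂μ₂|

/-- The empirical distribution `n⁻¹ ∑ᵢ δ_{xᵢ}` of a sample of size `n`. -/
def empirical {n : ℕ} (x : Fin n → Y) : Measure Y :=
  (n : ℝ≥0∞)⁻¹ • ∑ i, Measure.dirac (x i)

/-- The class `F` is uniformly bounded: `‖f‖_∞ ≤ b` for all `f ∈ F`, for some `b > 0`. -/
def UniformlyBounded (F : Set (Y → ℝ)) : Prop :=
  ∃ b : ℝ, 0 < b ∧ ∀ f ∈ F, ∀ x, |f x| ≤ b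

/-- The class `F` is measurable in the usual sense of empirical process theory: suprema over `F`
of finite weighted sums `|∑ᵢ aᵢ f(xᵢ)|` are measurable functions of the sample. -/
def MeasurableClass (F : Set (Y → ℝ)) : Prop :=
  ∀ (n : ℕ) (a : Fin n → ℝ),
    Measurable fun x : Fin n → Y => ⨆ f ∈ F, ENNReal.ofReal |∑ i, a i * f (x i)|

/-- The Rademacher complexity
`ℜ_{μ,n}(F) = 𝔼_{x,s} sup_{f ∈ F} |(1/n) ∑ᵢ sᵢ f(xᵢ)|` for `x₁, …, xₙ` i.i.d. from `μ` and
independent Rademacher signs `s₁, …, sₙ`; the expectation over the signs is the average over the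
`2 ^ n` sign vectors. -/
def rademacher (F : Set (Y → ℝ)) (μ : Measure Y) (n : ℕ) : ℝ≥0∞ :=
  (2 ^ n : ℝ≥0∞)⁻¹ * ∑ s : Fin n → ℤˣ,
    ∫⁻ x : Fin n → Y,
      ⨆ f ∈ F, ENNReal.ofReal |(1 / (n : ℝ)) * ∑ i, (((s i : ℤˣ) : ℤ) : ℝ) * f (x i)|
      ∂(Measure.pi fun _ : Fin n => μ)

/-- The uniform Rademacher complexity `ℜ_n(F) = sup_μ ℜ_{μ,n}(F)`, over all probability measures
`μ` on `Y`. -/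
def rademacherSup (F : Set (Y → ℝ)) (n : ℕ) : ℝ≥0∞ :=
  ⨆ μ : ProbabilityMeasure Y, rademacher F (μ : Measure Y) n

/-- The acceptance probability of the parameter `θ` given the data `y₁, …, yₙ`:
`∫ 1{𝒟_F(μ̂_z, μ̂_y) ≤ ε} μ_θⁿ(dz)`. -/
def acceptAt (F : Set (Y → ℝ)) (model : Kernel T Y) (ε : ℝ) {n : ℕ} (y : Fin n → Y)
    (θ : T) : ℝ≥0∞ :=
  (Measure.pi fun _ : Fin n => model θ)
    {z | ips F (empirical z) (empirical y) ≤ ENNReal.ofReal ε}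

/-- The overall acceptance probability `p_n = ∫ ∫ 1{𝒟_F(μ̂_z, μ̂_y) ≤ ε} μ_θⁿ(dz) π(dθ)`. -/
def acceptProb (F : Set (Y → ℝ)) (model : Kernel T Y) (prior : Measure T) (ε : ℝ) {n : ℕ}
    (y : Fin n → Y) : ℝ≥0∞ :=
  ∫⁻ θ, acceptAt F model ε y θ ∂prior

/-- The density, with respect to the prior, of the ABC posterior given `y₁, …, yₙ`. -/
def posteriorDensity (F : Set (Y → ℝ)) (model : Kernel T Y) (prior : Measure T) (ε : ℝ) {n : ℕ}
    (y : Fin n → Y) (θ : T) : ℝ≥0∞ :=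
  acceptAt F model ε y θ / acceptProb F model prior ε y

/-- The ABC posterior `π_n^{(ε)}(dθ) ∝ π(dθ) ∫ 1{𝒟_F(μ̂_z, μ̂_y) ≤ ε} μ_θⁿ(dz)`. It is a
probability measure as soon as `acceptProb` is positive. -/
def abcPosterior (F : Set (Y → ℝ)) (model : Kernel T Y) (prior : Measure T) (ε : ℝ) {n : ℕ}
    (y : Fin n → Y) : Measure T :=
  prior.withDensity (posteriorDensity F model prior ε y)

/-- The set `{θ : 𝒟_F(μ_θ, μ*) ≤ ε}`. -/
def truthBall (F : Set (Y → ℝ)) (model : Kernel T Y) (μstar : Measure Y) (ε : ℝ) : Set T :=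
  {θ | ips F (model θ) μstar ≤ ENNReal.ofReal ε}

/-- `ε̃ = inf {e > 0 : π{θ : 𝒟_F(μ_θ, μ*) ≤ e} > 0}`. -/
def epsTilde (F : Set (Y → ℝ)) (model : Kernel T Y) (prior : Measure T) (μstar : Measure Y) : ℝ :=
  sInf {e : ℝ | 0 < e ∧ 0 < prior (truthBall F model μstar e)}

/-- The total variation distance `sup_A |ν₁(A) - ν₂(A)|`, over measurable sets `A`. -/
def tvDist (ν₁ ν₂ : Measure T) : ℝ≥0∞ :=
  ⨆ (A : Set T) (_ : MeasurableSet A), ENNReal.ofReal |ν₁.real A - ν₂.real A|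

end ABC

end

/-! By the triangle inequality, `ips F (empirical z) (empirical y)` differs from `ips F (model θ)
μstar` by at most the distance of `empirical z` from `model θ` plus that of `empirical y` from
`μstar`. The data term vanishes almost surely (`ae_tendsto_ips_empirical`), the simulation term in
probability for each fixed `θ` (`tendsto_measure_ghostDist_ge`). So the acceptance probability tends
to 1 strictly inside the truth ball and to 0 strictly outside (`tendsto_acceptAt`). If the boundary
is null, dominated convergence gives the limit of `acceptProb`, hence that of the densities, and
Scheffé's lemma turns this into total variation.

Both laws of large numbers rest on symmetrization, `lintegral_ghostDist_le`. It is stated for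
`ghostDist`, a measurable majorant of the distance from `empirical z` to `μ`: the hypotheses give
measurability only for suprema of finite sums, not of integrals. The almost sure law needs no
concentration inequality: the sample is cut into blocks of a fixed length with small expected ghost
distance, and the ordinary strong law is applied to the block averages. -/

namespace ABC

/-! ### The semimetric on empirical measures, and the ghost sample. -/

section Semimetric

variable {Y : Type*} [MeasurableSpace Y]

theorem ips_comm (F : Set (Y → ℝ)) (μ ν : Measure Y) : ips F μ ν = ips F ν μ := by
  simp only [ips, abs_sub_comm]

theorem ips_triangle (F : Set (Y → ℝ)) (μ ν ρ : Measure Y) :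
    ips F μ ρ ≤ ips F μ ν + ips F ν ρ := by
  refine iSup₂_le fun f hf => ?_
  calc ENNReal.ofReal |(∫ x, f x ∂μ) - ∫ x, f x ∂ρ|
      ≤ ENNReal.ofReal (|(∫ x, f x ∂μ) - ∫ x, f x ∂ν| + |(∫ x, f x ∂ν) - ∫ x, f x ∂ρ|) :=
        ENNReal.ofReal_le_ofReal (abs_sub_le _ _ _)
    _ = _ := ENNReal.ofReal_add (abs_nonneg _) (abs_nonneg _)
    _ ≤ _ := add_le_add (le_iSup₂ (f := fun f (_ : f ∈ F) =>
        ENNReal.ofReal |(∫ x, f x ∂μ) - ∫ x, f x ∂ν|) f hf)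
        (le_iSup₂ (f := fun f (_ : f ∈ F) =>
        ENNReal.ofReal |(∫ x, f x ∂ν) - ∫ x, f x ∂ρ|) f hf)

theorem integral_empirical {f : Y → ℝ} (hf : Measurable f) {n : ℕ} (x : Fin n → Y) :
    ∫ t, f t ∂empirical x = (n : ℝ)⁻¹ * ∑ i, f (x i) := by
  rw [empirical, integral_smul_measure, integral_finsetSum_measure]
  · simp [integral_dirac' f _ hf.stronglyMeasurable]
  · intro i _
    exact integrable_dirac' hf.stronglyMeasurable (by simp)

theorem abs_integral_le_of_bound {f : Y → ℝ} {b : ℝ} (hb : ∀ x, |f x| ≤ b) (μ : Measure Y)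
    [IsProbabilityMeasure μ] : |∫ x, f x ∂μ| ≤ b := by
  have := norm_integral_le_of_norm_le_const (μ := μ) (f := f) (C := b)
    (ae_of_all _ fun x => hb x)
  simpa using this

/-- For `n = 0` the empirical measure is zero, which is why `NeZero n` recurs below. -/
instance {n : ℕ} [NeZero n] (x : Fin n → Y) : IsProbabilityMeasure (empirical x) := by
  constructor
  simp only [empirical, Measure.smul_apply, Measure.finsetSum_apply, measure_univ, Finset.sum_const,
    Finset.card_univ, Fintype.card_fin, smul_eq_mul, nsmul_eq_mul, mul_one]
  exact ENNReal.inv_mul_cancel (by simp [NeZero.ne n]) (by simp)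

theorem ips_le_of_bound {F : Set (Y → ℝ)} {b : ℝ} (hb : ∀ f ∈ F, ∀ x, |f x| ≤ b)
    (μ ν : Measure Y) [IsProbabilityMeasure μ] [IsProbabilityMeasure ν] :
    ips F μ ν ≤ ENNReal.ofReal (2 * b) := by
  refine iSup₂_le fun f hf => ENNReal.ofReal_le_ofReal ?_
  have h1 := abs_integral_le_of_bound (hb f hf) μ
  have h2 := abs_integral_le_of_bound (hb f hf) ν
  have := abs_sub (∫ x, f x ∂μ) (∫ x, f x ∂ν)
  linarith

theorem integral_integral_empirical {f : Y → ℝ} (hf : Measurable f) {b : ℝ}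
    (hb : ∀ x, |f x| ≤ b) (μ : Measure Y) [IsProbabilityMeasure μ] {n : ℕ} [NeZero n] :
    ∫ z : Fin n → Y, (∫ x, f x ∂empirical z) ∂(Measure.pi fun _ => μ) = ∫ x, f x ∂μ := by
  simp only [integral_empirical hf]
  have hint : Integrable f μ :=
    .of_bound hf.aestronglyMeasurable b (ae_of_all _ fun x => hb x)
  rw [integral_const_mul, integral_finsetSum]
  · simp only [integral_comp_eval (μ := fun _ : Fin n => μ) hint.aestronglyMeasurable]
    simp [NeZero.ne n]
  · intro i _
    exact (measurePreserving_eval (fun _ : Fin n => μ) i).integrable_comp_of_integrable hint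

/-- Jensen's inequality for `ips`: averaging the empirical measure can only decrease the
semimetric. -/
theorem ips_le_lintegral_ips_empirical {F : Set (Y → ℝ)} (hF : ∀ f ∈ F, Measurable f) {b : ℝ}
    (hb : ∀ f ∈ F, ∀ x, |f x| ≤ b) (μ ν : Measure Y) [IsProbabilityMeasure μ]
    {n : ℕ} [NeZero n] :
    ips F μ ν ≤ ∫⁻ z : Fin n → Y, ips F (empirical z) ν ∂(Measure.pi fun _ => μ) := by
  refine iSup₂_le fun f hf => ?_
  have hint : Integrable (fun z : Fin n → Y => ∫ x, f x ∂empirical z)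
      (Measure.pi fun _ => μ) := by
    refine .of_bound (C := b) ?_ (ae_of_all _ fun z => abs_integral_le_of_bound (hb f hf) _)
    simp only [integral_empirical (hF f hf)]
    have := hF f hf
    have : Measurable fun z : Fin n → Y => (n : ℝ)⁻¹ * ∑ i, f (z i) := by fun_prop
    exact this.aestronglyMeasurable
  have key : (∫ x, f x ∂μ) - ∫ x, f x ∂ν
      = ∫ z : Fin n → Y, ((∫ x, f x ∂empirical z) - ∫ x, f x ∂ν) ∂(Measure.pi fun _ => μ) := by
    rw [integral_sub hint (integrable_const _),
      integral_integral_empirical (hF f hf) (hb f hf) μ]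
    simp
  rw [key, ← Real.enorm_eq_ofReal_abs]
  refine (enorm_integral_le_lintegral_enorm _).trans (lintegral_mono fun z => ?_)
  rw [Real.enorm_eq_ofReal_abs]
  exact le_iSup₂ (f := fun f (_ : f ∈ F) =>
        ENNReal.ofReal |(∫ x, f x ∂empirical z) - ∫ x, f x ∂ν|) f hf

/-- The weighted suprema over `F` that `MeasurableClass` declares measurable. -/
theorem ips_empirical_empirical {F : Set (Y → ℝ)} (hF : ∀ f ∈ F, Measurable f) {n m : ℕ}
    (z : Fin n → Y) (w : Fin m → Y) :
    ips F (empirical z) (empirical w) = ⨆ f ∈ F, ENNReal.ofReal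
      |∑ i, Fin.append (fun _ : Fin n => (n : ℝ)⁻¹) (fun _ : Fin m => -(m : ℝ)⁻¹) i *
        f (Fin.append z w i)| := by
  refine iSup_congr fun f => iSup_congr fun hf => ?_
  rw [integral_empirical (hF f hf), integral_empirical (hF f hf), Fin.sum_univ_add]
  simp [Finset.mul_sum, sub_eq_add_neg]

theorem measurable_fin_append (n m : ℕ) :
    Measurable fun p : (Fin n → Y) × (Fin m → Y) => Fin.append p.1 p.2 := by
  refine measurable_pi_lambda _ fun i => ?_
  induction i using Fin.addCases with
  | left i => simp only [Fin.append_left]; fun_prop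
  | right i => simp only [Fin.append_right]; fun_prop

/-- Concatenating the two samples, with weights `1/n` and `-1/m`, reduces this to `MeasurableClass`.
-/
theorem measurable_ips_empirical {F : Set (Y → ℝ)} (hF : ∀ f ∈ F, Measurable f)
    (hFmeas : MeasurableClass F) (n m : ℕ) :
    Measurable fun p : (Fin n → Y) × (Fin m → Y) => ips F (empirical p.1) (empirical p.2) := by
  simp only [ips_empirical_empirical hF]
  exact (hFmeas (n + m) _).comp (measurable_fin_append n m)

/-- The expected distance of the empirical measure of `z` from that of an independent sample. -/
noncomputable def ghostDist (F : Set (Y → ℝ)) (μ : Measure Y) {n : ℕ} (z : Fin n → Y) : ℝ≥0∞ :=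
  ∫⁻ w : Fin n → Y, ips F (empirical z) (empirical w) ∂(Measure.pi fun _ => μ)

theorem measurable_ghostDist {F : Set (Y → ℝ)} (hF : ∀ f ∈ F, Measurable f)
    (hFmeas : MeasurableClass F) (μ : Measure Y) [IsProbabilityMeasure μ] (n : ℕ) :
    Measurable fun z : Fin n → Y => ghostDist F μ z :=
  (measurable_ips_empirical hF hFmeas n n).lintegral_prod_right'

/-- Jensen's inequality, since `μ` is the mean of the empirical measure of the ghost sample. -/
theorem ips_le_ghostDist {F : Set (Y → ℝ)} (hF : ∀ f ∈ F, Measurable f) {b : ℝ}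
    (hb : ∀ f ∈ F, ∀ x, |f x| ≤ b) (μ : Measure Y) [IsProbabilityMeasure μ]
    {n : ℕ} [NeZero n] (z : Fin n → Y) : ips F (empirical z) μ ≤ ghostDist F μ z := by
  rw [ips_comm]
  refine (ips_le_lintegral_ips_empirical hF hb μ (empirical z) (n := n)).trans
    (lintegral_mono fun w => ?_)
  simp only [ips_comm F (empirical w), le_refl]

theorem ghostDist_le {F : Set (Y → ℝ)} {b : ℝ} (hb : ∀ f ∈ F, ∀ x, |f x| ≤ b) (μ : Measure Y)
    [IsProbabilityMeasure μ] {n : ℕ} [NeZero n] (z : Fin n → Y) :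
    ghostDist F μ z ≤ ENNReal.ofReal (2 * b) := by
  refine (lintegral_mono fun w => ips_le_of_bound hb _ _).trans ?_
  simp

end Semimetric

/-! ### Symmetrization by random signs. -/

section Symmetrization

variable {Y : Type*}

/-- Swap the two coordinates of the pairs whose sign is `-1`. -/
def signSwap (s : ℤˣ) : Y × Y → Y × Y := if s = 1 then id else Prod.swap

theorem signSwap_sub (f : Y → ℝ) (s : ℤˣ) (p : Y × Y) :
    f (signSwap s p).1 - f (signSwap s p).2 = ((s : ℤ) : ℝ) * (f p.1 - f p.2) := by
  rcases Int.units_eq_one_or s with rfl | rfl <;> simp [signSwap]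

variable [MeasurableSpace Y]

theorem measurePreserving_signSwap (μ : Measure Y) [IsProbabilityMeasure μ] (s : ℤˣ) :
    MeasurePreserving (signSwap s) (μ.prod μ) (μ.prod μ) := by
  unfold signSwap
  split_ifs
  · exact .id _
  · exact Measure.measurePreserving_swap

theorem lintegral_pi_prod (μ : Measure Y) [IsProbabilityMeasure μ] {n : ℕ}
    {G : (Fin n → Y) × (Fin n → Y) → ℝ≥0∞} (hG : Measurable G) :
    ∫⁻ v : Fin n → Y × Y, G (fun i => (v i).1, fun i => (v i).2)
        ∂(Measure.pi fun _ => μ.prod μ)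
      = ∫⁻ z : Fin n → Y, ∫⁻ w : Fin n → Y, G (z, w) ∂(Measure.pi fun _ => μ)
        ∂(Measure.pi fun _ => μ) := by
  rw [← lintegral_prod _ hG.aemeasurable]
  exact (measurePreserving_arrowProdEquivProdArrow Y Y (Fin n) (fun _ => μ)
    (fun _ => μ)).lintegral_comp hG

/-- The inner supremum of the Rademacher complexity. -/
noncomputable def signedSup (F : Set (Y → ℝ)) {n : ℕ} (s : Fin n → ℤˣ) (x : Fin n → Y) : ℝ≥0∞ :=
  ⨆ f ∈ F, ENNReal.ofReal |(1 / (n : ℝ)) * ∑ i, (((s i : ℤˣ) : ℤ) : ℝ) * f (x i)|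

theorem measurable_signedSup {F : Set (Y → ℝ)} (hFmeas : MeasurableClass F) {n : ℕ}
    (s : Fin n → ℤˣ) : Measurable (signedSup F s) := by
  have := hFmeas n fun i => (1 / (n : ℝ)) * (((s i : ℤˣ) : ℤ) : ℝ)
  unfold signedSup
  simpa only [Finset.mul_sum, mul_assoc] using this

theorem ips_signSwap_le {F : Set (Y → ℝ)} (hF : ∀ f ∈ F, Measurable f) {n : ℕ} (s : Fin n → ℤˣ)
    (v : Fin n → Y × Y) :
    ips F (empirical fun i => (signSwap (s i) (v i)).1)
        (empirical fun i => (signSwap (s i) (v i)).2)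
      ≤ signedSup F s (fun i => (v i).1) + signedSup F s (fun i => (v i).2) := by
  refine iSup₂_le fun f hf => ?_
  rw [integral_empirical (hF f hf), integral_empirical (hF f hf), ← mul_sub,
    ← Finset.sum_sub_distrib]
  simp only [signSwap_sub, mul_sub, Finset.sum_sub_distrib]
  refine (ENNReal.ofReal_le_ofReal (abs_sub _ _)).trans ?_
  rw [ENNReal.ofReal_add (abs_nonneg _) (abs_nonneg _), ← one_div]
  exact add_le_add
    (le_iSup₂ (f := fun f (_ : f ∈ F) => ENNReal.ofReal
      |(1 / (n : ℝ)) * ∑ i, (((s i : ℤˣ) : ℤ) : ℝ) * f (v i).1|) f hf)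
    (le_iSup₂ (f := fun f (_ : f ∈ F) => ENNReal.ofReal
      |(1 / (n : ℝ)) * ∑ i, (((s i : ℤˣ) : ℤ) : ℝ) * f (v i).2|) f hf)

/-- Swapping sample and ghost entries wherever `s i = -1` preserves the joint law and puts the signs
on the differences. Splitting each difference gives two terms of equal mean, hence the factor 2. No
averaging over signs is needed yet. -/
theorem lintegral_ghostDist_le_signed {F : Set (Y → ℝ)} (hF : ∀ f ∈ F, Measurable f)
    (hFmeas : MeasurableClass F) (μ : Measure Y) [IsProbabilityMeasure μ] {n : ℕ}
    (s : Fin n → ℤˣ) :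
    ∫⁻ z : Fin n → Y, ghostDist F μ z ∂(Measure.pi fun _ => μ)
      ≤ 2 * ∫⁻ x : Fin n → Y, signedSup F s x ∂(Measure.pi fun _ => μ) := by
  have hm := measurable_ips_empirical hF hFmeas n n
  have hs := measurable_signedSup hFmeas s
  have hpres := measurePreserving_pi (fun _ : Fin n => μ.prod μ) (fun _ : Fin n => μ.prod μ)
    (fun i => measurePreserving_signSwap μ (s i))
  calc ∫⁻ z : Fin n → Y, ghostDist F μ z ∂(Measure.pi fun _ => μ)
      = ∫⁻ v : Fin n → Y × Y, ips F (empirical fun i => (v i).1) (empirical fun i => (v i).2)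
        ∂(Measure.pi fun _ => μ.prod μ) := (lintegral_pi_prod μ hm).symm
    _ = ∫⁻ v : Fin n → Y × Y, ips F (empirical fun i => (signSwap (s i) (v i)).1)
          (empirical fun i => (signSwap (s i) (v i)).2) ∂(Measure.pi fun _ => μ.prod μ) := by
        refine (hpres.lintegral_comp (f := fun v : Fin n → Y × Y =>
          ips F (empirical fun i => (v i).1) (empirical fun i => (v i).2)) ?_).symm
        exact hm.comp (g := fun p : (Fin n → Y) × (Fin n → Y) =>
          ips F (empirical p.1) (empirical p.2))
          (f := fun v : Fin n → Y × Y => (fun i => (v i).1, fun i => (v i).2)) (by fun_prop)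
    _ ≤ ∫⁻ v : Fin n → Y × Y, (signedSup F s (fun i => (v i).1)
          + signedSup F s (fun i => (v i).2)) ∂(Measure.pi fun _ => μ.prod μ) :=
        lintegral_mono fun v => ips_signSwap_le hF s v
    _ = ∫⁻ z : Fin n → Y, ∫⁻ w : Fin n → Y, (signedSup F s z + signedSup F s w)
          ∂(Measure.pi fun _ => μ) ∂(Measure.pi fun _ => μ) :=
        lintegral_pi_prod μ (G := fun p => signedSup F s p.1 + signedSup F s p.2) (by fun_prop)
    _ = _ := by
        simp only [lintegral_add_right _ hs, lintegral_const,
          measure_univ, mul_one]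
        rw [lintegral_add_left hs]
        simp [two_mul]

/-- Symmetrization. -/
theorem lintegral_ghostDist_le {F : Set (Y → ℝ)} (hF : ∀ f ∈ F, Measurable f)
    (hFmeas : MeasurableClass F) (μ : Measure Y) [IsProbabilityMeasure μ] (n : ℕ) :
    ∫⁻ z : Fin n → Y, ghostDist F μ z ∂(Measure.pi fun _ => μ) ≤ 2 * rademacherSup F n := by
  set I := ∫⁻ z : Fin n → Y, ghostDist F μ z ∂(Measure.pi fun _ => μ)
  have hle : rademacher F μ n ≤ rademacherSup F n :=
    le_iSup (fun ν : ProbabilityMeasure Y => rademacher F (ν : Measure Y) n) ⟨μ, inferInstance⟩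
  refine le_trans ?_ (mul_le_mul_right hle 2)
  -- `I` does not depend on the signs, so summing over all sign vectors yields `2 ^ n` copies of it.
  have hsum : (2 ^ n : ℝ≥0∞) * I ≤ ∑ s : Fin n → ℤˣ,
      2 * ∫⁻ x : Fin n → Y, signedSup F s x ∂(Measure.pi fun _ => μ) := by
    have := Finset.sum_le_sum fun (s : Fin n → ℤˣ) (_ : s ∈ Finset.univ) =>
      lintegral_ghostDist_le_signed hF hFmeas μ s
    simpa [Fintype.card_units_int] using this
  calc I = (2 ^ n : ℝ≥0∞)⁻¹ * ((2 ^ n : ℝ≥0∞) * I) := by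
        rw [← mul_assoc, ENNReal.inv_mul_cancel (by simp) (by simp), one_mul]
    _ ≤ (2 ^ n : ℝ≥0∞)⁻¹ * ∑ s : Fin n → ℤˣ,
        2 * ∫⁻ x : Fin n → Y, signedSup F s x ∂(Measure.pi fun _ => μ) := by gcongr
    _ = 2 * rademacher F μ n := by
        rw [← Finset.mul_sum, rademacher]
        simp only [signedSup]
        ring

end Symmetrization
-- Measurability in the parameter.
section Measurability

variable {Y : Type*} [MeasurableSpace Y] {T : Type*} [MeasurableSpace T]

/-- The kernel of samples of size `n`. -/
noncomputable def sampleKernel (model : Kernel T Y) [IsMarkovKernel model] (n : ℕ) :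
    Kernel T (Fin n → Y) where
  toFun θ := Measure.pi fun _ => model θ
  measurable' := by
    refine Measurable.measure_of_isPiSystem_of_isProbabilityMeasure
      (generateFrom_pi (α := fun _ : Fin n => Y)).symm isPiSystem_pi ?_
    rintro _ ⟨s, hs, rfl⟩
    simp only [Measure.pi_pi]
    exact Finset.measurable_prod _ fun i _ =>
      model.measurable_coe (hs i (Set.mem_univ i))

theorem measurable_acceptAt {F : Set (Y → ℝ)} (hF : ∀ f ∈ F, Measurable f)
    (hFmeas : MeasurableClass F) (model : Kernel T Y) [IsMarkovKernel model] (ε : ℝ) {n : ℕ}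
    (y : Fin n → Y) : Measurable (acceptAt F model ε y) := by
  have hm : Measurable fun z : Fin n → Y => ips F (empirical z) (empirical y) :=
    Measurable.comp (g := fun p : (Fin n → Y) × (Fin n → Y) => ips F (empirical p.1) (empirical p.2))
      (f := fun z => (z, y)) (measurable_ips_empirical hF hFmeas n n)
      (measurable_id.prodMk measurable_const)
  have hs : MeasurableSet {z : Fin n → Y |
      ips F (empirical z) (empirical y) ≤ ENNReal.ofReal ε} :=
    measurableSet_le hm measurable_const
  exact (sampleKernel model n).measurable_coe hs

/-- `F` may be uncountable, so the supremum is not measurable for free. It is a pointwise limit of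
the expected distances `D n` between two empirical measures: Jensen bounds `D n` below by the
semimetric, and symmetrization bounds it above up to an error `4 * rademacherSup F n`. -/
theorem measurable_ips_kernel {F : Set (Y → ℝ)} (hF : ∀ f ∈ F, Measurable f)
    (hFmeas : MeasurableClass F) {b : ℝ} (hb : ∀ f ∈ F, ∀ x, |f x| ≤ b)
    (hRad : Tendsto (fun n : ℕ => rademacherSup F n) atTop (𝓝 0))
    (model : Kernel T Y) [IsMarkovKernel model] (ν : Measure Y) [IsProbabilityMeasure ν] :
    Measurable fun θ => ips F (model θ) ν := by
  have hm (n : ℕ) := measurable_ips_empirical hF hFmeas n n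
  let D (n : ℕ) (θ : T) : ℝ≥0∞ := ∫⁻ z : Fin n → Y, ∫⁻ w : Fin n → Y,
    ips F (empirical z) (empirical w) ∂(Measure.pi fun _ => ν) ∂(Measure.pi fun _ => model θ)
  have hD (n : ℕ) : Measurable (D n) :=
    Measurable.lintegral_kernel (κ := sampleKernel model n) (hm n).lintegral_prod_right'
  refine ENNReal.measurable_of_tendsto hD (tendsto_pi_nhds.2 fun θ => ?_)
  have hlim : Tendsto (fun n => ips F (model θ) ν + (2 * rademacherSup F n
      + 2 * rademacherSup F n)) atTop (𝓝 (ips F (model θ) ν)) := by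
    have h2 : Tendsto (fun n => 2 * rademacherSup F n) atTop (𝓝 0) := by
      simpa using ENNReal.Tendsto.const_mul hRad (Or.inr (by simp : (2 : ℝ≥0∞) ≠ ∞))
    simpa using tendsto_const_nhds.add (h2.add h2)
  refine tendsto_of_tendsto_of_tendsto_of_le_of_le' tendsto_const_nhds hlim ?_ ?_
  · filter_upwards [eventually_ge_atTop 1] with n hn
    have : NeZero n := ⟨by omega⟩
    refine (ips_le_lintegral_ips_empirical hF hb (model θ) ν (n := n)).trans
      (lintegral_mono fun z => ?_)
    rw [ips_comm]
    refine (ips_le_lintegral_ips_empirical hF hb ν _ (n := n)).trans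
      (lintegral_mono fun w => ?_)
    rw [ips_comm]
  · filter_upwards [eventually_ge_atTop 1] with n hn
    have : NeZero n := ⟨by omega⟩
    have hν := measurable_ghostDist hF hFmeas ν n
    have hθ := measurable_ghostDist hF hFmeas (model θ) n
    calc D n θ ≤ ∫⁻ z : Fin n → Y, ∫⁻ w : Fin n → Y, (ghostDist F (model θ) z
          + ips F (model θ) ν + ghostDist F ν w)
          ∂(Measure.pi fun _ => ν) ∂(Measure.pi fun _ => model θ) := by
          refine lintegral_mono fun z => lintegral_mono fun w => ?_
          refine (ips_triangle F _ ν _).trans (add_le_add ?_ ?_)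
          · exact (ips_triangle F _ (model θ) _).trans
              (add_le_add (ips_le_ghostDist hF hb _ z) le_rfl)
          · rw [ips_comm]
            exact ips_le_ghostDist hF hb _ w
      _ = ∫⁻ z : Fin n → Y, ghostDist F (model θ) z ∂(Measure.pi fun _ => model θ)
          + ips F (model θ) ν + ∫⁻ w : Fin n → Y, ghostDist F ν w ∂(Measure.pi fun _ => ν) := by
          simp only [lintegral_add_right _ hν, lintegral_const, measure_univ, mul_one]
          rw [lintegral_add_right _ measurable_const, lintegral_add_right _ measurable_const]
          simp
      _ ≤ 2 * rademacherSup F n + ips F (model θ) ν + 2 * rademacherSup F n := by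
          gcongr
          · exact lintegral_ghostDist_le hF hFmeas (model θ) n
          · exact lintegral_ghostDist_le hF hFmeas ν n
      _ = _ := by ring

end Measurability

/-! ### The almost sure uniform law of large numbers. -/

section UniformLaw

variable {Y : Type*} [MeasurableSpace Y] {Ω : Type*} [MeasurableSpace Ω]

/-- The `j`-th block of length `m` of a sequence. -/
def block (m j : ℕ) (x : ℕ → Y) : Fin m → Y := fun l => x (m * j + l)

theorem sum_range_mul_eq {M : Type*} [AddCommMonoid M] (a : ℕ → M) (m k : ℕ) :
    ∑ i ∈ Finset.range (m * k), a i
      = ∑ j ∈ Finset.range k, ∑ l : Fin m, a (m * j + l) := by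
  induction k with
  | zero => simp
  | succ k ih =>
    rw [Nat.mul_succ, Finset.sum_range_add, ih, Finset.sum_range_succ,
      Fin.sum_univ_eq_sum_range (fun l => a (m * k + l))]

/-- The sum splits into `n / m` full blocks and fewer than `m` leftover terms, each at most `2 * b`.
If `H` serves all of `F`, so does the bound. -/
theorem abs_sum_le_blocks {f : Y → ℝ} (hf : Measurable f) {b : ℝ} (hb : ∀ x, |f x| ≤ b)
    (μ : Measure Y) [IsProbabilityMeasure μ] {m : ℕ} (hm : 0 < m) (H : (Fin m → Y) → ℝ)
    (hH : ∀ z : Fin m → Y, |(∫ t, f t ∂empirical z) - ∫ t, f t ∂μ| ≤ H z)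
    (x : ℕ → Y) (n : ℕ) :
    |∑ i : Fin n, (f (x i) - ∫ t, f t ∂μ)|
      ≤ m * ∑ j ∈ Finset.range (n / m), H (block m j x) + m * (2 * b) := by
  set c := ∫ t, f t ∂μ
  have hc : |c| ≤ b := abs_integral_le_of_bound hb μ
  have hm' : (m : ℝ) ≠ 0 := by positivity
  have hblock (j : ℕ) : |∑ l : Fin m, (f (x (m * j + l)) - c)| ≤ m * H (block m j x) := by
    have h := hH (block m j x)
    rw [integral_empirical hf] at h
    have e : ∑ l : Fin m, (f (x (m * j + l)) - c)
        = m * ((m : ℝ)⁻¹ * ∑ i, f (block m j x i) - c) := by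
      rw [Finset.sum_sub_distrib, mul_sub, mul_inv_cancel_left₀ hm']
      simp [block]
    rw [e, abs_mul, Nat.abs_cast]
    gcongr
  rw [Fin.sum_univ_eq_sum_range (fun i => f (x i) - c)]
  conv_lhs => rw [← Nat.div_add_mod n m, Finset.sum_range_add, sum_range_mul_eq]
  refine (abs_add_le _ _).trans (add_le_add ?_ ?_)
  · rw [Finset.mul_sum]
    exact (Finset.abs_sum_le_sum_abs _ _).trans (Finset.sum_le_sum fun j _ => hblock j)
  · refine (Finset.abs_sum_le_sum_abs _ _).trans ?_
    have hb0 : 0 ≤ b := (abs_nonneg _).trans hc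
    calc ∑ i ∈ Finset.range (n % m), |f (x (m * (n / m) + i)) - c|
        ≤ ∑ i ∈ Finset.range (n % m), 2 * b := by
          refine Finset.sum_le_sum fun i _ => ?_
          have := abs_sub (f (x (m * (n / m) + i))) c
          have := hb (x (m * (n / m) + i))
          linarith
      _ = (n % m : ℕ) * (2 * b) := by simp
      _ ≤ m * (2 * b) := by
          have := (Nat.mod_lt n hm).le
          gcongr

theorem hasLaw_block {μ : Measure Y} {P : Measure Ω} {y : ℕ → Ω → Y} (hindep : iIndepFun y P)
    (hlaw : ∀ i, HasLaw (y i) μ P) (m j : ℕ) :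
    HasLaw (fun ω => block m j fun i => y i ω) (Measure.pi fun _ => μ) P := by
  have hinj : Function.Injective fun l : Fin m => m * j + (l : ℕ) := fun a b h => by
    simpa [Fin.ext_iff] using h
  exact (hindep.precomp hinj).hasLaw_pi (fun l => hlaw _)

/-- Distinct blocks read disjoint index windows. Pairwise independence suffices for the strong law
used below. -/
theorem indepFun_block {μ : Measure Y} {P : Measure Ω} {y : ℕ → Ω → Y} (hindep : iIndepFun y P)
    (hlaw : ∀ i, HasLaw (y i) μ P) (m : ℕ) {j k : ℕ} (hjk : j ≠ k) :
    IndepFun (fun ω => block m j fun i => y i ω) (fun ω => block m k fun i => y i ω) P := by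
  let S (j : ℕ) : Finset ℕ := Finset.Ico (m * j) (m * (j + 1))
  have hmem (j : ℕ) (l : Fin m) : m * j + l ∈ S j := by
    simp [S, Nat.mul_succ]
  have hdisj : Disjoint (S j) (S k) := by
    rw [Finset.disjoint_left]
    intro i hi hi'
    simp only [S, Finset.mem_Ico] at hi hi'
    have h1 := lt_of_mul_lt_mul_left (hi.1.trans_lt hi'.2) (Nat.zero_le m)
    have h2 := lt_of_mul_lt_mul_left (hi'.1.trans_lt hi.2) (Nat.zero_le m)
    omega
  exact (hindep.indepFun_finset₀ (S j) (S k) hdisj fun i => (hlaw i).aemeasurable).comp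
    (φ := fun (v : S j → Y) (l : Fin m) => v ⟨m * j + l, hmem j l⟩)
    (ψ := fun (v : S k → Y) (l : Fin m) => v ⟨m * k + l, hmem k l⟩)
    (by fun_prop) (by fun_prop)

/-- The strong law of large numbers for the ghost distances of successive blocks. -/
theorem ae_tendsto_block_average {F : Set (Y → ℝ)} (hF : ∀ f ∈ F, Measurable f)
    (hFmeas : MeasurableClass F) {b : ℝ} (hb : ∀ f ∈ F, ∀ x, |f x| ≤ b) (μ : Measure Y)
    [IsProbabilityMeasure μ] {P : Measure Ω} [IsProbabilityMeasure P] {y : ℕ → Ω → Y}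
    (hindep : iIndepFun y P) (hlaw : ∀ i, HasLaw (y i) μ P) (m : ℕ) [NeZero m] :
    ∀ᵐ ω ∂P, Tendsto (fun k : ℕ => (∑ j ∈ Finset.range k,
      (ghostDist F μ (block m j fun i => y i ω)).toReal) / k) atTop
      (𝓝 (∫⁻ z : Fin m → Y, ghostDist F μ z ∂(Measure.pi fun _ => μ)).toReal) := by
  have hg := measurable_ghostDist hF hFmeas μ m
  have hlt (z : Fin m → Y) : ghostDist F μ z < ∞ :=
    (ghostDist_le hb μ z).trans_lt ENNReal.ofReal_lt_top
  have hblk := hasLaw_block hindep hlaw m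
  have hid (j : ℕ) : IdentDistrib (fun ω => (ghostDist F μ (block m j fun i => y i ω)).toReal)
      (fun ω => (ghostDist F μ (block m 0 fun i => y i ω)).toReal) P P :=
    IdentDistrib.comp (u := fun z : Fin m → Y => (ghostDist F μ z).toReal)
      ⟨(hblk j).aemeasurable, (hblk 0).aemeasurable, by rw [(hblk j).map_eq, (hblk 0).map_eq]⟩
      hg.ennreal_toReal
  have hint : Integrable (fun ω => (ghostDist F μ (block m 0 fun i => y i ω)).toReal) P := by
    refine .of_bound (C := (ENNReal.ofReal (2 * b)).toReal)
      (hid 0).aemeasurable_fst.aestronglyMeasurable (ae_of_all _ fun ω => ?_)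
    rw [Real.norm_of_nonneg ENNReal.toReal_nonneg]
    exact ENNReal.toReal_mono ENNReal.ofReal_ne_top (ghostDist_le hb μ _)
  have hlln := strong_law_ae_real
    (fun j ω => (ghostDist F μ (block m j fun i => y i ω)).toReal) hint
    (fun j k hjk => (indepFun_block hindep hlaw m hjk).comp hg.ennreal_toReal hg.ennreal_toReal)
    hid
  have hmean : ∫ ω, (ghostDist F μ (block m 0 fun i => y i ω)).toReal ∂P
      = (∫⁻ z : Fin m → Y, ghostDist F μ z ∂(Measure.pi fun _ => μ)).toReal := by
    rw [integral_toReal (f := fun ω => ghostDist F μ (block m 0 fun i => y i ω))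
      (hg.comp_aemeasurable (hblk 0).aemeasurable)
      (ae_of_all _ fun ω => hlt _), (hblk 0).lintegral_comp hg.aemeasurable]
  simpa only [hmean] using hlln

/-- The uniform law of large numbers over a class of vanishing Rademacher complexity. -/
theorem ae_tendsto_ips_empirical {F : Set (Y → ℝ)} (hF : ∀ f ∈ F, Measurable f)
    (hFmeas : MeasurableClass F) {b : ℝ} (hb : ∀ f ∈ F, ∀ x, |f x| ≤ b)
    (hRad : Tendsto (fun n : ℕ => rademacherSup F n) atTop (𝓝 0)) (μ : Measure Y)
    [IsProbabilityMeasure μ] {P : Measure Ω} [IsProbabilityMeasure P] {y : ℕ → Ω → Y}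
    (hindep : iIndepFun y P) (hlaw : ∀ i, HasLaw (y i) μ P) :
    ∀ᵐ ω ∂P, Tendsto (fun n : ℕ => ips F (empirical fun i : Fin n => y i ω) μ) atTop (𝓝 0) := by
  -- The block length will depend on the tolerance, so one null set must serve all lengths.
  have hall : ∀ᵐ ω ∂P, ∀ m : ℕ, Tendsto (fun k : ℕ => (∑ j ∈ Finset.range k,
      (ghostDist F μ (block (m + 1) j fun i => y i ω)).toReal) / k) atTop
      (𝓝 (∫⁻ z : Fin (m + 1) → Y, ghostDist F μ z ∂(Measure.pi fun _ => μ)).toReal) :=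
    ae_all_iff.2 fun m => ae_tendsto_block_average hF hFmeas hb μ hindep hlaw (m + 1)
  filter_upwards [hall] with ω hω
  rw [ENNReal.tendsto_nhds_zero]
  intro δ hδ
  obtain ⟨r, hr0, hrδ⟩ : ∃ r : ℝ, 0 < r ∧ ENNReal.ofReal r ≤ δ := by
    obtain ⟨r, hr0, hr⟩ := ENNReal.lt_iff_exists_nnreal_btwn.1 hδ
    exact ⟨r, by exact_mod_cast hr0, by simpa using hr.le⟩
  have h2 : Tendsto (fun n => 2 * rademacherSup F n) atTop (𝓝 0) := by
    simpa using ENNReal.Tendsto.const_mul hRad (Or.inr (by simp : (2 : ℝ≥0∞) ≠ ∞))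
  -- One half of `r` pays for the block average, the other for the leftover terms.
  obtain ⟨m, hm⟩ : ∃ m : ℕ, 2 * rademacherSup F (m + 1) < ENNReal.ofReal (r / 2) :=
    (((tendsto_add_atTop_iff_nat 1).2 h2).eventually_lt_const
      (ENNReal.ofReal_pos.2 (half_pos hr0))).exists
  have hI : (∫⁻ z : Fin (m + 1) → Y, ghostDist F μ z ∂(Measure.pi fun _ => μ)).toReal < r / 2 :=
    (ENNReal.toReal_lt_of_lt_ofReal
      ((lintegral_ghostDist_le hF hFmeas μ (m + 1)).trans_lt hm))
  have hdiv : Tendsto (fun n : ℕ => n / (m + 1)) atTop atTop :=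
    Nat.tendsto_div_const_atTop (by omega)
  have hev1 := ((hω m).comp hdiv).eventually_lt_const hI
  have hev2 : ∀ᶠ n : ℕ in atTop, ((m + 1 : ℕ) * (2 * b) / n : ℝ) < r / 2 :=
    (tendsto_const_div_atTop_nhds_zero_nat _).eventually_lt_const (half_pos hr0)
  filter_upwards [hev1, hev2, eventually_ge_atTop (m + 1)] with n h1 h2' hn
  refine le_trans (iSup₂_le fun f hf => ENNReal.ofReal_le_ofReal ?_) hrδ
  have hn0 : (0 : ℝ) < n := by exact_mod_cast (by omega : 0 < n)
  have hk0 : (0 : ℝ) < (n / (m + 1) : ℕ) := by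
    exact_mod_cast Nat.div_pos hn (by omega)
  have hH (z : Fin (m + 1) → Y) : |(∫ t, f t ∂empirical z) - ∫ t, f t ∂μ|
      ≤ (ghostDist F μ z).toReal := by
    refine (ENNReal.ofReal_le_iff_le_toReal
      ((ghostDist_le hb μ z).trans_lt ENNReal.ofReal_lt_top).ne).1 ?_
    exact (le_iSup₂ (f := fun f (_ : f ∈ F) =>
      ENNReal.ofReal |(∫ t, f t ∂empirical z) - ∫ t, f t ∂μ|) f hf).trans
      (ips_le_ghostDist hF hb μ z)
  have hsum := abs_sum_le_blocks (hF f hf) (hb f hf) μ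
    (Nat.succ_pos m) (fun z => (ghostDist F μ z).toReal) hH (fun i => y i ω) n
  set S := ∑ j ∈ Finset.range (n / (m + 1)),
    (ghostDist F μ (block (m + 1) j fun i => y i ω)).toReal with hS
  have hS0 : 0 ≤ S := Finset.sum_nonneg fun _ _ => ENNReal.toReal_nonneg
  have e : (∫ t, f t ∂empirical fun i : Fin n => y i ω) - ∫ t, f t ∂μ
      = (n : ℝ)⁻¹ * ∑ i : Fin n, (f (y i ω) - ∫ t, f t ∂μ) := by
    rw [integral_empirical (hF f hf), Finset.sum_sub_distrib, mul_sub]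
    simp [hn0.ne']
  have hkm : ((m + 1 : ℕ) : ℝ) * (n / (m + 1) : ℕ) ≤ n := by
    exact_mod_cast Nat.mul_div_le n (m + 1)
  have h1' : S / (n / (m + 1) : ℕ) < r / 2 := h1
  rw [div_lt_iff₀ hk0] at h1'
  rw [div_lt_iff₀ hn0] at h2'
  rw [e, abs_mul, abs_of_pos (inv_pos.2 hn0), inv_mul_le_iff₀ hn0]
  have hm0 : (0 : ℝ) < (m + 1 : ℕ) := by positivity
  have h3 : ((m + 1 : ℕ) : ℝ) * S ≤ r / 2 * n := by
    calc ((m + 1 : ℕ) : ℝ) * S ≤ (m + 1 : ℕ) * (r / 2 * (n / (m + 1) : ℕ)) := by gcongr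
      _ = r / 2 * ((m + 1 : ℕ) * (n / (m + 1) : ℕ)) := by ring
      _ ≤ _ := by gcongr
  linarith

end UniformLaw
-- Pointwise limits of the acceptance probability.
section Acceptance

variable {Y : Type*} [MeasurableSpace Y] {T : Type*} [MeasurableSpace T]

/-- Markov's inequality and symmetrization. -/
theorem tendsto_measure_ghostDist_ge {F : Set (Y → ℝ)} (hF : ∀ f ∈ F, Measurable f)
    (hFmeas : MeasurableClass F) (hRad : Tendsto (fun n : ℕ => rademacherSup F n) atTop (𝓝 0))
    (μ : Measure Y) [IsProbabilityMeasure μ] {δ : ℝ≥0∞} (hδ : δ ≠ 0) (hδ' : δ ≠ ∞) :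
    Tendsto (fun n : ℕ => (Measure.pi fun _ : Fin n => μ) {z | δ ≤ ghostDist F μ z}) atTop
      (𝓝 0) := by
  have hlim : Tendsto (fun n => 2 * rademacherSup F n / δ) atTop (𝓝 0) := by
    have h2 : Tendsto (fun n => 2 * rademacherSup F n) atTop (𝓝 0) := by
      simpa using ENNReal.Tendsto.const_mul hRad (Or.inr (by simp : (2 : ℝ≥0∞) ≠ ∞))
    simpa using ENNReal.Tendsto.div_const h2 (Or.inr hδ)
  refine tendsto_of_tendsto_of_tendsto_of_le_of_le tendsto_const_nhds hlim
    (fun _ => zero_le) fun n => ?_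
  exact (meas_ge_le_lintegral_div (measurable_ghostDist hF hFmeas μ n).aemeasurable hδ hδ').trans
    (ENNReal.div_le_div_right (lintegral_ghostDist_le hF hFmeas μ n) δ)

/-- One `δ` is for the error of the simulated sample, the other for that of the data. -/
theorem exists_add_add_lt {a b : ℝ≥0∞} (h : a < b) :
    ∃ δ : ℝ≥0∞, δ ≠ 0 ∧ δ ≠ ∞ ∧ a + (δ + δ) < b := by
  obtain ⟨r, hr0, hr⟩ := ENNReal.lt_iff_exists_add_pos_lt.1 h
  refine ⟨r / 2, by simp [hr0.ne'], ENNReal.div_ne_top (by simp) (by simp), ?_⟩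
  rwa [ENNReal.add_halves]

variable {F : Set (Y → ℝ)} {b : ℝ} {μstar : Measure Y} {model : Kernel T Y} {ε : ℝ}

theorem acceptAt_le_one [IsMarkovKernel model] {n : ℕ} (y : Fin n → Y) (θ : T) :
    acceptAt F model ε y θ ≤ 1 := prob_le_one

theorem tendsto_acceptAt_of_lt (hF : ∀ f ∈ F, Measurable f)
    (hFmeas : MeasurableClass F) (hb : ∀ f ∈ F, ∀ x, |f x| ≤ b)
    (hRad : Tendsto (fun n : ℕ => rademacherSup F n) atTop (𝓝 0)) [IsMarkovKernel model]
    {x : ℕ → Y}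
    (hx : Tendsto (fun n : ℕ => ips F (empirical fun i : Fin n => x i) μstar) atTop (𝓝 0))
    {θ : T} (hθ : ips F (model θ) μstar < ENNReal.ofReal ε) :
    Tendsto (fun n : ℕ => acceptAt F model ε (fun i : Fin n => x i) θ) atTop (𝓝 1) := by
  obtain ⟨δ, hδ0, hδt, hδ⟩ := exists_add_add_lt hθ
  have hlim := ENNReal.Tendsto.sub (tendsto_const_nhds (x := (1 : ℝ≥0∞)))
    (tendsto_measure_ghostDist_ge hF hFmeas hRad (model θ) hδ0 hδt) (Or.inl (by simp))
  rw [tsub_zero] at hlim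
  refine tendsto_of_tendsto_of_tendsto_of_le_of_le' hlim tendsto_const_nhds ?_
    (Eventually.of_forall fun n => acceptAt_le_one _ θ)
  filter_upwards [ENNReal.tendsto_nhds_zero.1 hx δ (pos_iff_ne_zero.2 hδ0),
    eventually_ge_atTop 1] with n hn hn1
  have : NeZero n := ⟨by omega⟩
  -- Every `z` is either accepted or has ghost distance at least `δ`.
  rw [tsub_le_iff_right, ← measure_univ (μ := Measure.pi fun _ : Fin n => model θ)]
  refine (measure_mono fun z _ => ?_).trans (measure_union_le _ _)
  by_cases hz : δ ≤ ghostDist F (model θ) z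
  · exact Or.inr hz
  · refine Or.inl (le_trans ?_ hδ.le)
    calc ips F (empirical z) (empirical fun i : Fin n => x i)
        ≤ ips F (empirical z) (model θ) + (ips F (model θ) μstar
          + ips F μstar (empirical fun i : Fin n => x i)) :=
          (ips_triangle F _ (model θ) _).trans
            (add_le_add le_rfl (ips_triangle F _ μstar _))
      _ ≤ δ + (ips F (model θ) μstar + δ) := by
          rw [ips_comm F μstar]
          gcongr
          exact (ips_le_ghostDist hF hb _ z).trans (not_le.1 hz).le
      _ = _ := by ring

theorem tendsto_acceptAt_of_gt (hF : ∀ f ∈ F, Measurable f)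
    (hFmeas : MeasurableClass F) (hb : ∀ f ∈ F, ∀ x, |f x| ≤ b)
    (hRad : Tendsto (fun n : ℕ => rademacherSup F n) atTop (𝓝 0)) [IsMarkovKernel model]
    {x : ℕ → Y}
    (hx : Tendsto (fun n : ℕ => ips F (empirical fun i : Fin n => x i) μstar) atTop (𝓝 0))
    {θ : T} (hθ : ENNReal.ofReal ε < ips F (model θ) μstar) :
    Tendsto (fun n : ℕ => acceptAt F model ε (fun i : Fin n => x i) θ) atTop (𝓝 0) := by
  obtain ⟨δ, hδ0, hδt, hδ⟩ := exists_add_add_lt hθ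
  refine tendsto_of_tendsto_of_tendsto_of_le_of_le' tendsto_const_nhds
    (tendsto_measure_ghostDist_ge hF hFmeas hRad (model θ) hδ0 hδt)
    (Eventually.of_forall fun n => zero_le) ?_
  filter_upwards [ENNReal.tendsto_nhds_zero.1 hx δ (pos_iff_ne_zero.2 hδ0),
    eventually_ge_atTop 1] with n hn hn1
  have : NeZero n := ⟨by omega⟩
  refine measure_mono fun z hz => ?_
  by_contra hcon
  refine absurd hδ (not_lt.2 ?_)
  calc ips F (model θ) μstar
      ≤ ips F (model θ) (empirical z) + (ips F (empirical z) (empirical fun i : Fin n => x i)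
          + ips F (empirical fun i : Fin n => x i) μstar) :=
        (ips_triangle F _ (empirical z) _).trans
          (add_le_add le_rfl (ips_triangle F _ _ _))
    _ ≤ δ + (ENNReal.ofReal ε + δ) := by
        rw [ips_comm F (model θ)]
        exact add_le_add ((ips_le_ghostDist hF hb _ z).trans (not_le.1 hcon).le)
          (add_le_add hz hn)
    _ = _ := by ring

theorem tendsto_acceptAt (hF : ∀ f ∈ F, Measurable f)
    (hFmeas : MeasurableClass F) (hb : ∀ f ∈ F, ∀ x, |f x| ≤ b)
    (hRad : Tendsto (fun n : ℕ => rademacherSup F n) atTop (𝓝 0)) [IsMarkovKernel model]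
    {x : ℕ → Y}
    (hx : Tendsto (fun n : ℕ => ips F (empirical fun i : Fin n => x i) μstar) atTop (𝓝 0))
    {θ : T} (hθ : ips F (model θ) μstar ≠ ENNReal.ofReal ε) :
    Tendsto (fun n : ℕ => acceptAt F model ε (fun i : Fin n => x i) θ) atTop
      (𝓝 ((truthBall F model μstar ε).indicator 1 θ)) := by
  rcases hθ.lt_or_gt with h | h
  · rw [Set.indicator_of_mem (show θ ∈ truthBall F model μstar ε from h.le)]
    exact tendsto_acceptAt_of_lt hF hFmeas hb hRad hx h
  · rw [Set.indicator_of_notMem (show θ ∉ truthBall F model μstar ε from not_le.2 h)]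
    exact tendsto_acceptAt_of_gt hF hFmeas hb hRad hx h

end Acceptance

/-! ### Balls around the data distribution. -/

section TruthBall

variable {Y : Type*} [MeasurableSpace Y] {T : Type*} [MeasurableSpace T]

theorem truthBall_mono (F : Set (Y → ℝ)) (model : Kernel T Y) (μstar : Measure Y) {e ε : ℝ}
    (h : e ≤ ε) : truthBall F model μstar e ⊆ truthBall F model μstar ε :=
  fun _ hθ => le_trans hθ (ENNReal.ofReal_le_ofReal h)

theorem exists_lt_of_epsTilde_lt {F : Set (Y → ℝ)} {b : ℝ} (hb0 : 0 < b)
    (hb : ∀ f ∈ F, ∀ x, |f x| ≤ b) (model : Kernel T Y) [IsMarkovKernel model]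
    (prior : Measure T) [IsProbabilityMeasure prior] (μstar : Measure Y)
    [IsProbabilityMeasure μstar] {ε : ℝ} (hε : epsTilde F model prior μstar < ε) :
    ∃ e, 0 < e ∧ e < ε ∧ 0 < prior (truthBall F model μstar e) := by
  -- Rules out the default `sInf ∅ = 0`; the ball of radius `2 * b` is everything.
  have hne : {e : ℝ | 0 < e ∧ 0 < prior (truthBall F model μstar e)}.Nonempty := by
    refine ⟨2 * b, by positivity, ?_⟩
    have : truthBall F model μstar (2 * b) = Set.univ :=
      Set.eq_univ_of_forall fun θ => ips_le_of_bound hb _ _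
    simp [this]
  obtain ⟨e, he, hlt⟩ := exists_lt_of_csInf_lt hne hε
  exact ⟨e, he.1, hlt, he.2⟩

end TruthBall

/-! ### Total variation and Scheffé's lemma. -/

section TotalVariation

variable {T : Type*} [MeasurableSpace T]

/-- Subtraction in `ℝ≥0∞` is truncated, so an absolute difference is the sum of both one-sided ones.
-/
theorem ofReal_abs_toReal_sub_le {x y : ℝ≥0∞} (hx : x ≠ ∞) (hy : y ≠ ∞) :
    ENNReal.ofReal |x.toReal - y.toReal| ≤ (x - y) + (y - x) := by
  rcases le_total x y with h | h
  · rw [abs_sub_comm, ← ENNReal.toReal_sub_of_le h hy, abs_of_nonneg ENNReal.toReal_nonneg]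
    exact ENNReal.ofReal_toReal_le.trans le_add_self
  · rw [← ENNReal.toReal_sub_of_le h hx, abs_of_nonneg ENNReal.toReal_nonneg]
    exact ENNReal.ofReal_toReal_le.trans le_self_add

theorem setLIntegral_sub_le {μ : Measure T} {f g : T → ℝ≥0∞} (hg : Measurable g) (A : Set T) :
    (∫⁻ t in A, f t ∂μ) - ∫⁻ t in A, g t ∂μ ≤ ∫⁻ t, (f t - g t) ∂μ := by
  rw [tsub_le_iff_left]
  calc ∫⁻ t in A, f t ∂μ ≤ ∫⁻ t in A, (g t + (f t - g t)) ∂μ :=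
        lintegral_mono fun t => le_add_tsub
    _ = ∫⁻ t in A, g t ∂μ + ∫⁻ t in A, (f t - g t) ∂μ := lintegral_add_left hg _
    _ ≤ _ := by gcongr; exact Measure.restrict_le_self

theorem tvDist_withDensity_le {μ : Measure T} {f g : T → ℝ≥0∞} (hf : Measurable f)
    (hg : Measurable g) (hf' : ∫⁻ t, f t ∂μ ≠ ∞) (hg' : ∫⁻ t, g t ∂μ ≠ ∞) :
    tvDist (μ.withDensity f) (μ.withDensity g)
      ≤ ∫⁻ t, (f t - g t) ∂μ + ∫⁻ t, (g t - f t) ∂μ := by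
  refine iSup₂_le fun A hA => ?_
  simp only [measureReal_def, withDensity_apply _ hA]
  exact (ofReal_abs_toReal_sub_le
    (ne_top_of_le_ne_top hf' (setLIntegral_le_lintegral _ _))
    (ne_top_of_le_ne_top hg' (setLIntegral_le_lintegral _ _))).trans
    (add_le_add (setLIntegral_sub_le hg A) (setLIntegral_sub_le hf A))

/-- Scheffé's lemma for uniformly bounded densities. -/
theorem tendsto_tvDist_withDensity {μ : Measure T} [IsFiniteMeasure μ] {f : ℕ → T → ℝ≥0∞}
    {g : T → ℝ≥0∞} (hf : ∀ n, Measurable (f n)) (hg : Measurable g) {C : ℝ≥0∞} (hC : C ≠ ∞)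
    (hfC : ∀ᶠ n in atTop, ∀ t, f n t ≤ C) (hgC : ∀ t, g t ≤ C)
    (hfg : ∀ᵐ t ∂μ, Tendsto (fun n => f n t) atTop (𝓝 (g t))) :
    Tendsto (fun n => tvDist (μ.withDensity (f n)) (μ.withDensity g)) atTop (𝓝 0) := by
  have hCint : ∫⁻ _, C ∂μ ≠ ∞ := by
    rw [lintegral_const]
    exact ENNReal.mul_ne_top hC (measure_ne_top _ _)
  have hgt (t : T) : g t ≠ ∞ := ne_top_of_le_ne_top hC (hgC t)
  have h1 : Tendsto (fun n => ∫⁻ t, (f n t - g t) ∂μ) atTop (𝓝 0) := by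
    have := tendsto_lintegral_filter_of_dominated_convergence (μ := μ) (l := atTop)
      (F := fun n t => f n t - g t) (f := fun t => g t - g t) (fun _ => C)
      (.of_forall fun n => (hf n).sub hg)
      (hfC.mono fun n hn => ae_of_all _ fun t => tsub_le_self.trans (hn t)) hCint
      (hfg.mono fun t ht => ENNReal.Tendsto.sub ht tendsto_const_nhds (Or.inl (hgt t)))
    simpa using this
  have h2 : Tendsto (fun n => ∫⁻ t, (g t - f n t) ∂μ) atTop (𝓝 0) := by
    have := tendsto_lintegral_filter_of_dominated_convergence (μ := μ) (l := atTop)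
      (F := fun n t => g t - f n t) (f := fun t => g t - g t) (fun _ => C)
      (.of_forall fun n => hg.sub (hf n))
      (.of_forall fun n => ae_of_all _ fun t => tsub_le_self.trans (hgC t)) hCint
      (hfg.mono fun t ht => ENNReal.Tendsto.sub tendsto_const_nhds ht (Or.inl (hgt t)))
    simpa using this
  have h12 := h1.add h2
  rw [add_zero] at h12
  refine tendsto_of_tendsto_of_tendsto_of_le_of_le' tendsto_const_nhds h12
    (.of_forall fun _ => zero_le) (hfC.mono fun n hn => ?_)
  exact tvDist_withDensity_le (hf n) hg
    (ne_top_of_le_ne_top hCint (lintegral_mono hn)) (ne_top_of_le_ne_top hCint (lintegral_mono hgC))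

theorem cond_eq_withDensity (μ : Measure T) {B : Set T} (hB : MeasurableSet B) :
    μ[|B] = μ.withDensity (B.indicator fun _ => (μ B)⁻¹) := by
  rw [withDensity_indicator hB, withDensity_const]
  rfl

end TotalVariation

end ABC

/-! ### Convergence of the ABC posterior. -/

theorem corollary1 {Y : Type*} [MeasurableSpace Y] {p : ℕ}
    (Θ : Set (EuclideanSpace ℝ (Fin p)))
    (model : Kernel Θ Y) [IsMarkovKernel model]
    (prior : Measure Θ) [IsProbabilityMeasure prior]
    (g : Y → ℝ) (_hg : Measurable g) (_hg1 : ∀ x, 1 ≤ g x)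
    (F : Set (Y → ℝ)) (hF : F ⊆ ABC.gBounded g)
    (hFmeas : ABC.MeasurableClass F)
    (hFbdd : ABC.UniformlyBounded F)
    (hRad : Tendsto (fun n : ℕ => ABC.rademacherSup F n) atTop (𝓝 0))
    (μstar : Measure Y) [IsProbabilityMeasure μstar]
    {Ω : Type*} [MeasurableSpace Ω] (P : Measure Ω) [IsProbabilityMeasure P]
    (y : ℕ → Ω → Y) (hindep : iIndepFun y P) (hlaw : ∀ i, HasLaw (y i) μstar P)
    (ε : ℝ) (hε : ABC.epsTilde F model prior μstar < ε) :
    0 < prior (ABC.truthBall F model μstar ε) ∧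
    (∀ᵐ ω ∂P, ∀ᶠ n : ℕ in atTop,
      0 < ABC.acceptProb F model prior ε (fun i : Fin n => y i ω)) ∧
    (prior {θ | ABC.ips F (model θ) μstar = ENNReal.ofReal ε} = 0 →
      ∀ᵐ ω ∂P,
        Tendsto
          (fun n : ℕ => ABC.tvDist
            (ABC.abcPosterior F model prior ε (fun i : Fin n => y i ω))
            (prior[|ABC.truthBall F model μstar ε]))
          atTop (𝓝 0) ∧
        ∀ θ : Θ, ABC.ips F (model θ) μstar ≠ ENNReal.ofReal ε →
          Tendsto
            (fun n : ℕ => ABC.posteriorDensity F model prior ε (fun i : Fin n => y i ω) θ)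
            atTop
            (𝓝 ((ABC.truthBall F model μstar ε).indicator
              (fun _ => (prior (ABC.truthBall F model μstar ε))⁻¹) θ))) := by
  obtain ⟨b, hb0, hb⟩ := hFbdd
  have hFm : ∀ f ∈ F, Measurable f := fun f hf => (hF hf).1
  obtain ⟨e, he0, heε, hepos⟩ := ABC.exists_lt_of_epsTilde_lt hb0 hb model prior μstar hε
  have hpos : 0 < prior (ABC.truthBall F model μstar ε) :=
    hepos.trans_le (measure_mono (ABC.truthBall_mono F model μstar heε.le))
  have hips := ABC.measurable_ips_kernel hFm hFmeas hb hRad model μstar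
  have hball (r : ℝ) : MeasurableSet (ABC.truthBall F model μstar r) :=
    measurableSet_le hips measurable_const
  have hacc (n : ℕ) (x : Fin n → Y) := ABC.measurable_acceptAt hFm hFmeas model ε x
  have hlln := ABC.ae_tendsto_ips_empirical hFm hFmeas hb hRad μstar hindep hlaw
  refine ⟨hpos, ?_, fun hnull => ?_⟩
  · filter_upwards [hlln] with ω hω
    -- The boundary may carry mass here, so a smaller ball of positive prior mass is used; all its
    -- points are strictly inside radius `ε`.
    have hone : ∀ θ ∈ ABC.truthBall F model μstar e, Tendsto
        (fun n : ℕ => ABC.acceptAt F model ε (fun i : Fin n => y i ω) θ) atTop (𝓝 1) :=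
      fun θ hθ => by
        have hlt : ENNReal.ofReal e < ENNReal.ofReal ε :=
          (ENNReal.ofReal_lt_ofReal_iff (he0.trans heε)).2 heε
        have hle : ABC.ips F (model θ) μstar ≤ ENNReal.ofReal e := hθ
        exact ABC.tendsto_acceptAt_of_lt (x := fun i => y i ω) hFm hFmeas hb hRad hω
          (hle.trans_lt hlt)
    have hlim := tendsto_lintegral_of_dominated_convergence
      (μ := prior.restrict (ABC.truthBall F model μstar e))
      (F := fun n θ => ABC.acceptAt F model ε (fun i : Fin n => y i ω) θ) (f := fun _ => 1)
      (fun _ => 1) (fun n => hacc n _)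
      (fun n => ae_of_all _ (ABC.acceptAt_le_one _)) (by simp)
      (ae_restrict_of_forall_mem (hball e) hone)
    rw [lintegral_one, Measure.restrict_apply_univ] at hlim
    filter_upwards [hlim.eventually_const_lt hepos] with n hn
    exact hn.trans_le (setLIntegral_le_lintegral _ _)
  · filter_upwards [hlln] with ω hω
    set B := ABC.truthBall F model μstar ε with hB
    have hne : ∀ᵐ θ ∂prior, ABC.ips F (model θ) μstar ≠ ENNReal.ofReal ε := by
      rw [ae_iff]
      simpa using hnull
    have hp : Tendsto (fun n : ℕ => ABC.acceptProb F model prior ε (fun i : Fin n => y i ω))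
        atTop (𝓝 (prior B)) := by
      have := tendsto_lintegral_of_dominated_convergence (μ := prior)
        (F := fun n θ => ABC.acceptAt F model ε (fun i : Fin n => y i ω) θ) (f := B.indicator 1)
        (fun _ => 1) (fun n => hacc n _)
        (fun n => ae_of_all _ (ABC.acceptAt_le_one _)) (by simp)
        (hne.mono fun θ hθ => ABC.tendsto_acceptAt (x := fun i => y i ω) hFm hFmeas hb hRad hω hθ)
      rwa [lintegral_indicator_one (hball ε)] at this
    have hdens (θ : Θ) (hθ : ABC.ips F (model θ) μstar ≠ ENNReal.ofReal ε) : Tendsto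
        (fun n : ℕ => ABC.posteriorDensity F model prior ε (fun i : Fin n => y i ω) θ) atTop
        (𝓝 (B.indicator (fun _ => (prior B)⁻¹) θ)) := by
      have := ENNReal.Tendsto.div (ABC.tendsto_acceptAt (x := fun i => y i ω) hFm hFmeas hb hRad hω hθ)
        (Or.inr hpos.ne') hp (Or.inl (measure_ne_top _ _))
      have hind : B.indicator 1 θ / prior B = B.indicator (fun _ => (prior B)⁻¹) θ := by
        by_cases h : θ ∈ B <;> simp [h]
      rwa [← hB, hind] at this
    refine ⟨?_, hdens⟩
    -- Eventually `acceptProb` exceeds `prior B / 2`, so the inverse of this number dominates the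
    -- densities.
    have hhalf : prior B / 2 < prior B := ENNReal.half_lt_self hpos.ne' (measure_ne_top _ _)
    rw [ABC.cond_eq_withDensity prior (hball ε)]
    refine ABC.tendsto_tvDist_withDensity (C := (prior B / 2)⁻¹)
      (fun n => (hacc n _).div measurable_const) (measurable_const.indicator (hball ε))
      (ENNReal.inv_ne_top.2 (ENNReal.half_pos hpos.ne').ne') ?_ ?_ (hne.mono hdens)
    · filter_upwards [hp.eventually_const_lt hhalf] with n hn θ
      rw [ABC.posteriorDensity, div_eq_mul_inv]
      calc _ ≤ 1 * (prior B / 2)⁻¹ :=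
            mul_le_mul' (ABC.acceptAt_le_one _ θ) (ENNReal.inv_le_inv.2 hn.le)
        _ = _ := one_mul _
    · exact Set.indicator_le' (fun _ _ => ENNReal.inv_le_inv.2 hhalf.le) fun _ _ => zero_le
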